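/- Let $N\cong\mathbb Z^n$ be a lattice, $M=\mathrm{Hom}(N,\mathbb Z)$, and let $\sigma\subseteq N_{\mathbb R}=N\otimes_{\mathbb Z}\mathbb R$ be an $n$-dimensional strongly convex rational polyhedral cone. Let $n_1,\dots,n_s\in N$ be the primitive generators of the one-dimensional faces of $\sigma$. Assume that $\sigma$ is a Gorenstein canonical cone, i.e. there is $m_0\in M$ with $\langle m_0,n_i\rangle=1$ for all $i$ and $\langle m_0,v\rangle\ge 1$ for all $v\in\sigma\cap(N\setminus\{0\})$. Let $P$ be the convex hull of $n_1,\dots,n_s$ (a polytope in the hyperplane $\langle m_0,\cdot\rangle=1$). Suppose given a triangulation of $P$ such that the cones over its simplices, together with $\{0\}$, form a fan $\Sigma$ of rational cones whose toric variety $Y_\Sigma$ over $\mathbb C$ is non-singular. Let $T_{\mathbb C}(N)=N\otimes_{\mathbb Z}\mathbb C^*=\mathrm{Spec}\,\mathbb C[M]\subseteq Y_\Sigma$ be the dense torus (the open subset belonging to the cone $\{0\}$). Let $e_1,\dots,e_n$ be a basis of $N$ whose dual basis $e_1^*,\dots,e_n^*$ satisfies $m_0=e_1^*+\cdots+e_n^*$,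 and let $z_1,\dots,z_n$ be the coordinates on $T_{\mathbb C}(N)$ given by the characters $e_1^*,\dots,e_n^*$. **Proposition 2.1.** If $\Omega$ is a nowhere vanishing regular (algebraic) $n$-form on $Y_\Sigma$, i.e. a nowhere vanishing global section of $\Omega^n_{Y_\Sigma/\mathbb C}$, then there is a constant $C\in\mathbb C$ with $$\Omega|_{T_{\mathbb C}(N)}=C\,dz_1\wedge\cdots\wedge dz_n .$$ -/

import Mathlib

open CategoryTheory CategoryTheory.Limits AlgebraicGeometry
open scoped TensorProduct

noncomputable section

namespace Toric

/-! ### Lattices, cones and faces -/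

section Cones

variable {N : Type} [AddCommGroup N]

/-- The real vector space `N_ℝ = ℝ ⊗ N` attached to a lattice `N`. -/
abbrev RealSpan (N : Type) [AddCommGroup N] : Type := ℝ ⊗[ℤ] N

/-- The image of a lattice vector in `N_ℝ`. -/
abbrev toReal (v : N) : RealSpan N := (1 : ℝ) ⊗ₜ[ℤ] v

/-- The pairing `⟨m, x⟩` of `m ∈ M = Hom(N, ℤ)` with `x ∈ N_ℝ`. -/
abbrev pair (m : Module.Dual ℤ N) (x : RealSpan N) : ℝ := m.baseChange ℝ x

/-- `σ` is a strongly convex rational polyhedral cone: it is generated by finitely many lattice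
vectors and contains no line. -/
structure IsStronglyConvexRational (σ : PointedCone ℝ (RealSpan N)) : Prop where
  rational : ∃ S : Finset N, σ = PointedCone.hull ℝ (toReal '' (S : Set N))
  salient : (σ : ConvexCone ℝ (RealSpan N)).Salient

/-- The monoid `σ^∨ ∩ M` of lattice functionals that are nonnegative on `σ`. -/
def dualMonoid (σ : PointedCone ℝ (RealSpan N)) : AddSubmonoid (Module.Dual ℤ N) where
  carrier := {m | ∀ x ∈ σ, 0 ≤ pair m x}
  zero_mem' := by intro x _; simp [pair]
  add_mem' := by
    intro a b ha hb x hx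
    have := add_nonneg (ha x hx) (hb x hx)
    simpa [pair] using this

/-- `τ` is a face of the rational cone `σ`: `τ = σ ∩ m^⊥` for some `m ∈ σ^∨ ∩ M`. -/
def IsFace (τ σ : PointedCone ℝ (RealSpan N)) : Prop :=
  ∃ m ∈ dualMonoid σ, ∀ x, x ∈ τ ↔ x ∈ σ ∧ pair m x = 0

/-- The generators `n_1, …, n_s ∈ N` of the one-dimensional faces of `σ`: the lattice vectors
`v ≠ 0` such that `ℝ_{≥0} v` is a face of `σ` and `ℝ_{≥0} v ∩ N = ℕ v`. -/
def rayGenerators (σ : PointedCone ℝ (RealSpan N)) : Set N :=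
  {v | v ≠ 0 ∧ IsFace (PointedCone.hull ℝ {toReal v}) σ ∧
    ∀ w : N, toReal w ∈ PointedCone.hull ℝ {toReal v} → ∃ k : ℕ, w = k • v}

/-- `σ` is a Gorenstein canonical cone, as witnessed by `m₀ ∈ M`. -/
structure IsGorensteinCanonical (σ : PointedCone ℝ (RealSpan N)) (m₀ : Module.Dual ℤ N) :
    Prop where
  stronglyConvexRational : IsStronglyConvexRational σ
  apply_rayGenerator : ∀ v ∈ rayGenerators σ, m₀ v = 1
  one_le : ∀ v : N, v ≠ 0 → toReal v ∈ σ → 1 ≤ m₀ v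

/-- The polytope `P`: the convex hull of the generators of the rays of `σ`. -/
def rayPolytope (σ : PointedCone ℝ (RealSpan N)) : Set (RealSpan N) :=
  convexHull ℝ (toReal '' rayGenerators σ)

/-- A fan of strongly convex rational polyhedral cones in `N_ℝ`. It is finite and, as is usual,
nonempty; equivalently, it contains the cone `{0}`. -/
structure Fan (N : Type) [AddCommGroup N] where
  cones : Set (PointedCone ℝ (RealSpan N))
  finite : cones.Finite
  stronglyConvexRational : ∀ σ ∈ cones, IsStronglyConvexRational σ
  zero_mem : ⊥ ∈ cones
  face_mem : ∀ σ ∈ cones, ∀ τ, IsFace τ σ → τ ∈ cones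
  inter_face : ∀ σ ∈ cones, ∀ τ ∈ cones, IsFace (σ ⊓ τ) σ

/-- The fan `Δ` consists of the cones over the simplices of the simplicial complex `K`,
the cone over the empty simplex being `{0}`. -/
def Fan.IsConeOver (Δ : Fan N) (K : Geometry.SimplicialComplex ℝ (RealSpan N)) : Prop :=
  Δ.cones = insert ⊥ {τ | ∃ s ∈ K.faces, τ = PointedCone.hull ℝ (s : Set (RealSpan N))}

lemma dualMonoid_anti {τ σ : PointedCone ℝ (RealSpan N)} (h : τ ≤ σ) :
    dualMonoid σ ≤ dualMonoid τ := fun _ hm x hx => hm x (h hx)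

/-- If the face `τ` of `σ` is cut out by `m`, then `τ^∨ ∩ M = σ^∨ ∩ M + ℕ (-m)`. -/
lemma exists_add_nsmul_mem {τ σ : PointedCone ℝ (RealSpan N)} (hσ : IsStronglyConvexRational σ)
    {m : Module.Dual ℤ N} (hm : m ∈ dualMonoid σ) (h : ∀ x, x ∈ τ ↔ x ∈ σ ∧ pair m x = 0)
    {w : Module.Dual ℤ N} (hw : w ∈ dualMonoid τ) : ∃ k : ℕ, w + k • m ∈ dualMonoid σ := by
  obtain ⟨S, rfl⟩ := hσ.rational
  have hS : ∀ s ∈ S, toReal s ∈ PointedCone.hull ℝ (toReal '' (S : Set N)) := fun s hs =>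
    Submodule.subset_span ⟨s, hs, rfl⟩
  refine ⟨∑ s ∈ S, (w s).natAbs, fun x hx => ?_⟩
  induction hx using Submodule.span_induction with
  | mem x hx =>
    obtain ⟨s, hs, rfl⟩ := hx
    have h1 : (0 : ℝ) ≤ (m s : ℝ) := by simpa [pair] using hm _ (hS s hs)
    have hk : (w s).natAbs ≤ ∑ s ∈ S, (w s).natAbs :=
      Finset.single_le_sum (f := fun s => (w s).natAbs) (fun _ _ => Nat.zero_le _) hs
    generalize ∑ s ∈ S, (w s).natAbs = k at hk
    suffices 0 ≤ w s + k * m s by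
      have h2 : (0 : ℝ) ≤ ((w s + k * m s : ℤ) : ℝ) := by exact_mod_cast this
      simpa [pair] using h2
    have h1' : 0 ≤ m s := by exact_mod_cast h1
    rcases h1'.eq_or_lt with h0 | h0
    · have : toReal s ∈ τ := (h _).2 ⟨hS s hs, by simp [pair, ← h0]⟩
      have h3 : (0 : ℝ) ≤ (w s : ℝ) := by simpa [pair] using hw _ this
      have h3' : 0 ≤ w s := by exact_mod_cast h3
      rw [← h0]; omega
    · have : (k : ℤ) ≤ k * m s := le_mul_of_one_le_right (by omega) h0
      omega
  | zero => simp [pair]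
  | add x y _ _ hx hy =>
    simp only [pair, map_add] at hx hy ⊢
    linarith
  | smul a x _ hx =>
    have : a • x = (a : ℝ) • x := rfl
    simp only [pair] at hx ⊢
    rw [this, map_smul]
    exact mul_nonneg a.2 hx

/-! ### Affine toric varieties -/

/-- The coordinate ring `ℂ[σ^∨ ∩ M]`. -/
abbrev CoordRing (σ : PointedCone ℝ (RealSpan N)) : Type := AddMonoidAlgebra ℂ (dualMonoid σ)

/-- The character `χ^m`, as an element of `ℂ[σ^∨ ∩ M]`. -/
abbrev chi {σ : PointedCone ℝ (RealSpan N)} (m : dualMonoid σ) : CoordRing σ :=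
  AddMonoidAlgebra.single m 1

/-- The inclusion `ℂ[σ^∨ ∩ M] → ℂ[τ^∨ ∩ M]` for `τ ⊆ σ`. -/
def coordMap {τ σ : PointedCone ℝ (RealSpan N)} (h : τ ≤ σ) : CoordRing σ →ₐ[ℂ] CoordRing τ :=
  AddMonoidAlgebra.mapDomainAlgHom ℂ ℂ (AddSubmonoid.inclusion (dualMonoid_anti h))

lemma coordMap_chi {τ σ : PointedCone ℝ (RealSpan N)} (h : τ ≤ σ) (m : dualMonoid σ) :
    coordMap h (chi m) = chi (AddSubmonoid.inclusion (dualMonoid_anti h) m) := by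
  simp [coordMap, chi]

lemma coordMap_self {σ : PointedCone ℝ (RealSpan N)} (h : σ ≤ σ) (x : CoordRing σ) :
    coordMap h x = x := by
  induction x using AddMonoidAlgebra.induction_linear with
  | zero => simp
  | add f g hf hg => rw [map_add, hf, hg]
  | single w a =>
    simp only [coordMap, AddMonoidAlgebra.mapDomainAlgHom_apply, AddMonoidAlgebra.mapDomain_single]
    rfl

lemma coordMap_coordMap {ρ τ σ : PointedCone ℝ (RealSpan N)} (h : ρ ≤ τ) (h' : τ ≤ σ)
    (x : CoordRing σ) : coordMap h (coordMap h' x) = coordMap (h.trans h') x := by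
  induction x using AddMonoidAlgebra.induction_linear with
  | zero => simp
  | add f g hf hg => rw [map_add, map_add, map_add, hf, hg]
  | single w a =>
    simp only [coordMap, AddMonoidAlgebra.mapDomainAlgHom_apply, AddMonoidAlgebra.mapDomain_single]
    rfl

lemma coordMap_injective {τ σ : PointedCone ℝ (RealSpan N)} (h : τ ≤ σ) :
    Function.Injective (coordMap h) :=
  AddMonoidAlgebra.mapDomain_injective (AddSubmonoid.inclusion_injective _)

lemma chi_pow {σ : PointedCone ℝ (RealSpan N)} (m : dualMonoid σ) (k : ℕ) :
    chi m ^ k = chi (k • m) := by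
  simp [chi, AddMonoidAlgebra.single_pow]

/-- If `τ` is the face of `σ` cut out by `m`, then `ℂ[τ^∨ ∩ M]` is the localization of
`ℂ[σ^∨ ∩ M]` at `χ^m`. -/
lemma isLocalization_coordMap {τ σ : PointedCone ℝ (RealSpan N)} (hτσ : τ ≤ σ)
    (hσ : IsStronglyConvexRational σ) {m : Module.Dual ℤ N} (hm : m ∈ dualMonoid σ)
    (h : ∀ x, x ∈ τ ↔ x ∈ σ ∧ pair m x = 0) :
    let := (coordMap hτσ).toRingHom.toAlgebra
    IsLocalization.Away (chi ⟨m, hm⟩ : CoordRing σ) (CoordRing τ) := by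
  let := (coordMap hτσ).toRingHom.toAlgebra
  have halg : ∀ x, algebraMap (CoordRing σ) (CoordRing τ) x = coordMap hτσ x := fun _ => rfl
  refine (isLocalization_iff _ _).2 ⟨?_, ?_, ?_⟩
  · rintro ⟨_, k, rfl⟩
    have hneg : -m ∈ dualMonoid τ := fun x hx => by simp [pair, ((h x).1 hx).2]
    rw [map_pow, halg, coordMap_chi]
    refine IsUnit.pow _ (IsUnit.of_mul_eq_one (chi ⟨-m, hneg⟩) ?_)
    rw [AddMonoidAlgebra.single_mul_single, AddMonoidAlgebra.one_def, one_mul]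
    congr 1
    ext1
    simp
  · have key : ∀ z : CoordRing τ, ∃ k : ℕ, ∃ x : CoordRing σ,
        z * coordMap hτσ (chi ⟨m, hm⟩ ^ k) = coordMap hτσ x := by
      intro z
      induction z using AddMonoidAlgebra.induction_linear with
      | zero => exact ⟨0, 0, by simp⟩
      | add f g hf hg =>
        obtain ⟨k, x, hx⟩ := hf
        obtain ⟨l, y, hy⟩ := hg
        refine ⟨k + l, x * chi ⟨m, hm⟩ ^ l + y * chi ⟨m, hm⟩ ^ k, ?_⟩
        rw [map_add, map_mul, map_mul, ← hx, ← hy, pow_add, map_mul]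
        ring
      | single w a =>
        obtain ⟨k, hk⟩ := exists_add_nsmul_mem hσ hm h w.2
        refine ⟨k, AddMonoidAlgebra.single ⟨_, hk⟩ a, ?_⟩
        rw [chi_pow, coordMap_chi, AddMonoidAlgebra.single_mul_single, mul_one]
        simp only [coordMap, AddMonoidAlgebra.mapDomainAlgHom_apply,
          AddMonoidAlgebra.mapDomain_single]
        rfl
    intro z
    obtain ⟨k, x, hx⟩ := key z
    exact ⟨(x, ⟨_, k, rfl⟩), hx⟩
  · intro x y hxy
    exact ⟨1, by rw [coordMap_injective hτσ hxy]⟩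

end Cones

/-! ### The toric variety of a fan -/

section Variety

variable {N : Type} [AddCommGroup N] (Δ : Fan N)

/-- The base scheme `Spec ℂ`. -/
abbrev SpecC : Scheme.{0} := Spec (CommRingCat.of ℂ)

/-- The diagram of the affine toric varieties `Spec ℂ[τ^∨ ∩ M]`, `τ ∈ Δ`, and the inclusions
`Spec ℂ[τ^∨ ∩ M] ⊆ Spec ℂ[σ^∨ ∩ M]` for `τ ⊆ σ`. -/
def Fan.diagram : Δ.cones ⥤ Scheme.{0} where
  obj τ := Spec (CommRingCat.of (CoordRing τ.1))
  map f := Spec.map (CommRingCat.ofHom (coordMap (leOfHom f)).toRingHom)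
  map_id τ := by
    rw [← Spec.map_id]
    exact congrArg Spec.map (CommRingCat.hom_ext (RingHom.ext fun x => coordMap_self le_rfl x))
  map_comp f g := by
    rw [← Spec.map_comp]
    exact congrArg Spec.map (CommRingCat.hom_ext (RingHom.ext fun x =>
      (coordMap_coordMap (leOfHom f) (leOfHom g) x).symm))

lemma Fan.isFace_of_le {τ σ : Δ.cones} (h : τ ≤ σ) : IsFace τ.1 σ.1 := by
  have := Δ.inter_face σ.1 σ.2 τ.1 τ.2
  rwa [inf_eq_right.2 h] at this

instance {τ σ : Δ.cones} (f : τ ⟶ σ) : IsOpenImmersion (Δ.diagram.map f) := by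
  obtain ⟨m, hm, h⟩ := Δ.isFace_of_le (leOfHom f)
  let := (coordMap (leOfHom f)).toRingHom.toAlgebra
  have := isLocalization_coordMap (leOfHom f) (Δ.stronglyConvexRational _ σ.2) hm h
  exact IsOpenImmersion.of_isLocalization (chi ⟨m, hm⟩)

lemma Fan.mem_range_diagram_map {τ σ : Δ.cones} (f : τ ⟶ σ) {m : Module.Dual ℤ N}
    (hm : m ∈ dualMonoid σ.1) (h : ∀ x, x ∈ τ.1 ↔ x ∈ σ.1 ∧ pair m x = 0)
    (p : PrimeSpectrum (CoordRing σ.1)) :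
    p ∈ Set.range (PrimeSpectrum.comap (coordMap (leOfHom f)).toRingHom) ↔
      chi ⟨m, hm⟩ ∉ p.asIdeal := by
  let := (coordMap (leOfHom f)).toRingHom.toAlgebra
  have := isLocalization_coordMap (leOfHom f) (Δ.stronglyConvexRational _ σ.2) hm h
  have := PrimeSpectrum.localization_away_comap_range (CoordRing τ.1)
    (chi ⟨m, hm⟩ : CoordRing σ.1)
  exact (Set.ext_iff.1 this p)

instance : (Δ.diagram ⋙ Scheme.forget).IsLocallyDirected where
  cond {i j k} fi fj xi xj hx := by
    obtain ⟨mi, hmi, hi⟩ := Δ.isFace_of_le (leOfHom fi)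
    obtain ⟨mj, hmj, hj⟩ := Δ.isFace_of_le (leOfHom fj)
    let l : Δ.cones := ⟨i.1 ⊓ j.1, Δ.face_mem _ i.2 _ (Δ.inter_face _ i.2 _ j.2)⟩
    have hli : l ≤ i := inf_le_left (a := i.1)
    have hlj : l ≤ j := inf_le_right (a := i.1)
    have hl : ∀ x, x ∈ l.1 ↔ x ∈ k.1 ∧ pair (mi + mj) x = 0 := by
      intro x
      have : x ∈ l.1 ↔ x ∈ i.1 ∧ x ∈ j.1 := Iff.rfl
      rw [this, hi, hj]
      have hadd : pair (mi + mj) x = pair mi x + pair mj x := by simp [pair]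
      rw [hadd]
      constructor
      · rintro ⟨⟨h1, h2⟩, -, h3⟩
        exact ⟨h1, by linarith⟩
      · rintro ⟨h1, h2⟩
        have h3 := hmi x h1
        have h4 := hmj x h1
        exact ⟨⟨h1, by linarith⟩, h1, by linarith⟩
    let p : PrimeSpectrum (CoordRing k.1) :=
      PrimeSpectrum.comap (coordMap (leOfHom fi)).toRingHom xi
    have hp' : p = PrimeSpectrum.comap (coordMap (leOfHom fj)).toRingHom xj := hx
    have hpi := (Δ.mem_range_diagram_map fi hmi hi p).1 ⟨xi, rfl⟩
    have hpj := (Δ.mem_range_diagram_map fj hmj hj p).1 ⟨xj, hp'.symm⟩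
    obtain ⟨x, hxp⟩ := (Δ.mem_range_diagram_map (homOfLE hli ≫ fi) (add_mem hmi hmj) hl p).2 (by
      have : (chi ⟨mi + mj, add_mem hmi hmj⟩ : CoordRing k.1) = chi ⟨mi, hmi⟩ * chi ⟨mj, hmj⟩ := by
        rw [AddMonoidAlgebra.single_mul_single, one_mul]
        rfl
      rw [this]
      exact fun hmem => (p.2.mem_or_mem hmem).elim hpi hpj)
    have hx1 : Δ.diagram.map (homOfLE hli ≫ fi) x = p := hxp
    have hx2 : Δ.diagram.map (homOfLE hlj ≫ fj) x = p := hxp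
    refine ⟨l, homOfLE hli, homOfLE hlj, x, ?_, ?_⟩
    · apply (Δ.diagram.map fi).isOpenEmbedding.injective
      rw [Functor.map_comp] at hx1
      exact hx1
    · apply (Δ.diagram.map fj).isOpenEmbedding.injective
      rw [Functor.map_comp] at hx2
      exact hx2.trans hp'

/-- The structure morphisms `Spec ℂ[τ^∨ ∩ M] → Spec ℂ`. -/
def Fan.diagramCocone : Cocone Δ.diagram where
  pt := SpecC
  ι.app τ := Spec.map (CommRingCat.ofHom (algebraMap ℂ (CoordRing τ.1)))
  ι.naturality τ σ f := by
    change Spec.map _ ≫ Spec.map _ = Spec.map _ ≫ 𝟙 _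
    rw [Category.comp_id, ← Spec.map_comp]
    exact congrArg Spec.map (CommRingCat.hom_ext (RingHom.ext fun x =>
      (coordMap (leOfHom f)).commutes x))

/-- The toric variety `Y_Δ`, a scheme over `ℂ`: the affine toric varieties `Spec ℂ[τ^∨ ∩ M]`,
`τ ∈ Δ`, glued along their common faces. -/
def Fan.toricVariety : Over SpecC :=
  Over.mk (colimit.desc Δ.diagram Δ.diagramCocone)

/-- The open immersion `Spec ℂ[τ^∨ ∩ M] → Y_Δ`. -/
def Fan.chart (τ : Δ.cones) : Spec (CommRingCat.of (CoordRing τ.1)) ⟶ Δ.toricVariety.left :=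
  colimit.ι Δ.diagram τ

instance (τ : Δ.cones) : IsOpenImmersion (Δ.chart τ) :=
  inferInstanceAs (IsOpenImmersion (colimit.ι Δ.diagram τ))

/-- The cone `{0}` of a fan. -/
def Fan.zeroCone : Δ.cones := ⟨⊥, Δ.zero_mem⟩

/-- The dense torus `T_ℂ(N) = Spec ℂ[M] ⊆ Y_Δ`, the open subset belonging to the cone `{0}`. -/
def Fan.torus : Δ.toricVariety.left.affineOpens :=
  ⟨Δ.chart Δ.zeroCone ''ᵁ ⊤, (isAffineOpen_top _).image_of_isOpenImmersion _⟩

lemma mem_dualMonoid_bot (m : Module.Dual ℤ N) :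
    m ∈ dualMonoid (⊥ : PointedCone ℝ (RealSpan N)) := by
  intro x hx
  rw [Submodule.mem_bot] at hx
  simp [hx, pair]

/-- The character of `T_ℂ(N)` given by `m ∈ M`, as a regular function on `T_ℂ(N) ⊆ Y_Δ`. -/
def Fan.character (m : Module.Dual ℤ N) : Γ(Δ.toricVariety.left, Δ.torus.1) :=
  ((Scheme.ΓSpecIso (CommRingCat.of (CoordRing Δ.zeroCone.1))).inv ≫
    ((Δ.chart Δ.zeroCone).appIso ⊤).inv) (chi ⟨m, mem_dualMonoid_bot m⟩ : CoordRing Δ.zeroCone.1)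

end Variety

/-! ### Regular differential forms -/

section Forms

/-- The `n`-forms `⋀^n Ω_{A/ℂ}` of a commutative `ℂ`-algebra `A`. -/
abbrev AlgForm (n : ℕ) (A : Type) [CommRing A] [Algebra ℂ A] : Type := ⋀[A]^n Ω[A⁄ℂ]

/-- The form `df_1 ∧ ⋯ ∧ df_n`. -/
def wedgeD {n : ℕ} {A : Type} [CommRing A] [Algebra ℂ A] (f : Fin n → A) : AlgForm n A :=
  exteriorPower.ιMulti A n fun i => KaehlerDifferential.D ℂ A (f i)

/-- The pull-back of forms `g df_1 ∧ ⋯ ∧ df_n ↦ φ(g) dφ(f_1) ∧ ⋯ ∧ dφ(f_n)` along a homomorphism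
`φ : A → B` of `ℂ`-algebras. -/
def AlgForm.map (n : ℕ) {A B : Type} [CommRing A] [CommRing B] [Algebra ℂ A] [Algebra ℂ B]
    (φ : A →ₐ[ℂ] B) : AlgForm n A →+ AlgForm n B :=
  letI : Algebra A B := φ.toRingHom.toAlgebra
  haveI : IsScalarTower ℂ A B := IsScalarTower.of_algebraMap_eq fun x => (φ.commutes x).symm
  letI f : Ω[A⁄ℂ] [⋀^Fin n]→ₗ[A] AlgForm n B :=
    { toFun := fun v => exteriorPower.ιMulti B n fun i => KaehlerDifferential.map ℂ ℂ A B (v i)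
      map_update_add' := by
        intro _ v i x y
        have hc : ∀ (u : Ω[A⁄ℂ]), (fun j =>
            KaehlerDifferential.map ℂ ℂ A B (Function.update v i u j)) =
            Function.update (fun j => KaehlerDifferential.map ℂ ℂ A B (v j)) i
              (KaehlerDifferential.map ℂ ℂ A B u) := by
          intro u
          funext j
          exact Function.apply_update (fun _ => KaehlerDifferential.map ℂ ℂ A B) v i u j
        rw [hc, hc, hc, map_add, AlternatingMap.map_update_add]
      map_update_smul' := by
        intro _ v i c x
        have hc : ∀ (u : Ω[A⁄ℂ]), (fun j =>
            KaehlerDifferential.map ℂ ℂ A B (Function.update v i u j)) =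
            Function.update (fun j => KaehlerDifferential.map ℂ ℂ A B (v j)) i
              (KaehlerDifferential.map ℂ ℂ A B u) := by
          intro u
          funext j
          exact Function.apply_update (fun _ => KaehlerDifferential.map ℂ ℂ A B) v i u j
        rw [hc, hc, map_smul, ← algebraMap_smul B c, AlternatingMap.map_update_smul,
          algebraMap_smul]
      map_eq_zero_of_eq' := by
        intro v i j hij hne
        exact (exteriorPower.ιMulti B n).map_eq_zero_of_eq _ (by simp [hij]) hne }
  (exteriorPower.alternatingMapLinearEquiv f).toAddMonoidHom

variable (X : Over SpecC)

lemma le_preimage_top (U : X.left.Opens) : U ≤ X.hom ⁻¹ᵁ ⊤ := by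
  rw [Scheme.Hom.preimage_top]
  exact le_top

/-- The regular functions on an open subset of a scheme over `ℂ` form a `ℂ`-algebra. -/
instance sectionsAlgebra (U : X.left.Opens) : Algebra ℂ Γ(X.left, U) :=
  ((Scheme.ΓSpecIso (CommRingCat.of ℂ)).inv ≫ X.hom.appLE ⊤ U (le_preimage_top X U)).hom.toAlgebra

/-- Restriction of regular functions to a smaller open subset. -/
def resAlgHom {U V : X.left.Opens} (h : V ≤ U) : Γ(X.left, U) →ₐ[ℂ] Γ(X.left, V) :=
  { (X.left.presheaf.map (homOfLE h).op).hom with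
    commutes' := by
      intro c
      change ((X.hom.appLE ⊤ U (le_preimage_top X U)) ≫ X.left.presheaf.map (homOfLE h).op)
        ((Scheme.ΓSpecIso (CommRingCat.of ℂ)).inv c) = _
      rw [Scheme.Hom.appLE_map]
      rfl }

/-- A global section of `Ω^n_{X/ℂ} = ⋀^n Ω_{X/ℂ}`, that is, a regular `n`-form on `X`: a form in
`⋀^n Ω_{Γ(X,U)/ℂ}` on each affine open subset `U`, compatibly with restrictions. -/
structure RegularForm (n : ℕ) where
  form : ∀ U : X.left.affineOpens, AlgForm n Γ(X.left, U.1)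
  res : ∀ (U V : X.left.affineOpens) (h : V.1 ≤ U.1),
    AlgForm.map n (resAlgHom X h) (form U) = form V

variable {X}

/-- The form `ω` vanishes nowhere: its value in the fibre `κ(p) ⊗ Ω^n` at each point `p` of each
affine open subset is nonzero. -/
def RegularForm.NowhereVanishing {n : ℕ} (ω : RegularForm X n) : Prop :=
  ∀ (U : X.left.affineOpens) (p : PrimeSpectrum Γ(X.left, U.1)),
    (1 : p.asIdeal.ResidueField) ⊗ₜ[Γ(X.left, U.1)] ω.form U ≠ 0

end Forms

end Toric

end

/-
On the torus `Ω = a dz₁ ∧ ⋯ ∧ dzₙ` with `a` nowhere zero, so `a = c χ^k` with `k ∈ M`, and the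
claim is that `k = 0`. Let `v` generate a ray of `σ`. As `v` is an extreme point of `P`, it is a
vertex of the triangulation and `ℝ≥0 v` is a cone of the fan. Complete `v` to a basis `b` of `N`;
on the chart of `ℝ≥0 v` the forms `dχ^{bᵢ*}` generate `Ω¹`, so `Ω = c' χ^{k'} dχ^{b₁*} ∧ ⋯ ∧
dχ^{bₙ*}` with `χ^{k'}` a unit there, that is, `k'(v) = 0`. Contracting both expressions with the
invariant vector fields `χ^m ↦ ⟨m, eⱼ⟩ χ^m` gives `k + m₀ = k' + b₁* + ⋯ + bₙ*`, and at `v` this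
reads `k(v) + 1 = 1`. The rays of `σ` span `N_ℝ`, hence `k = 0`.
-/

noncomputable section

namespace Toric

section Lattice

variable {N : Type*} [AddCommGroup N]

lemma exists_basis_of_dual_apply_eq_one {R M : Type*} [CommRing R] [IsDomain R]
    [IsPrincipalIdealRing R] [AddCommGroup M] [Module R M] {n : ℕ} (e : Module.Basis (Fin n) R M)
    {v : M} {u : Module.Dual R M} (huv : u v = 1) :
    ∃ (b : Module.Basis (Fin n) R M) (i : Fin n), b i = v := by
  obtain ⟨k, b₀⟩ := Submodule.basisOfPid e (LinearMap.ker u)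
  let b : Module.Basis (Fin (k + 1)) R M := Module.Basis.mkFinCons v b₀
    (fun c x hx h => by simpa [huv, LinearMap.mem_ker.1 hx] using congrArg u h)
    (fun z => ⟨-u z, by simp [huv]⟩)
  have hk : k + 1 = n := by
    simpa using (Module.finrank_eq_card_basis b).symm.trans (Module.finrank_eq_card_basis e)
  exact ⟨b.reindex (finCongr hk), finCongr hk 0, by simp [b]⟩

lemma exists_eq_nsmul_and_dual_apply_eq_one [Module.Free ℤ N] {s : N}
    (hs : s ≠ 0) : ∃ (v : N) (u : Module.Dual ℤ N) (d : ℕ), 0 < d ∧ s = d • v ∧ u v = 1 := by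
  let e := Module.Free.chooseBasis ℤ N
  obtain ⟨a, ha⟩ := (IsPrincipalIdealRing.principal
    (LinearMap.range (Module.Dual.eval ℤ N s) : Ideal ℤ)).principal
  rw [Ideal.submodule_span_eq, ← Int.span_natAbs] at ha
  set d := a.natAbs
  have hdvd (i) : (d : ℤ) ∣ e.repr s i := by
    rw [← Ideal.mem_span_singleton, ← ha]
    exact ⟨e.coord i, rfl⟩
  obtain ⟨u, hu⟩ : (d : ℤ) ∈ LinearMap.range (Module.Dual.eval ℤ N s) :=
    ha ▸ Ideal.mem_span_singleton_self _
  let v := e.repr.symm ((e.repr s).mapRange (· / (d : ℤ)) (Int.zero_ediv _))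
  have hsv : s = d • v := e.repr.injective <| Finsupp.ext fun i => by
    simp [v, Int.mul_ediv_cancel' (hdvd i)]
  have hd : d ≠ 0 := fun h => hs (by rw [hsv, h, zero_smul])
  refine ⟨v, u, d, hd.pos, hsv, mul_left_cancel₀ (Nat.cast_ne_zero.2 hd) ?_⟩
  rw [← nsmul_eq_mul, ← map_nsmul, ← hsv, mul_one]
  exact hu

end Lattice

section Cones

variable {N : Type} [AddCommGroup N] {σ : PointedCone ℝ (RealSpan N)}

lemma pair_toReal (m : Module.Dual ℤ N) (v : N) : pair m (toReal v) = m v := by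
  simp

lemma toReal_nsmul (d : ℕ) (v : N) : toReal (d • v) = (d : ℝ) • toReal v := by
  simp [toReal, TensorProduct.tmul_smul, Nat.cast_smul_eq_nsmul]

lemma toReal_injective [Module.Free ℤ N] : Function.Injective (toReal : N → RealSpan N) := by
  intro v w h
  rw [← sub_eq_zero, ← Module.forall_dual_apply_eq_zero_iff ℤ]
  intro m
  have := congrArg (pair m) h
  rw [pair_toReal, pair_toReal] at this
  rw [map_sub, sub_eq_zero]
  exact_mod_cast this

lemma mem_dualMonoid_hull {S : Set N} {m : Module.Dual ℤ N} :
    m ∈ dualMonoid (PointedCone.hull ℝ (toReal '' S)) ↔ ∀ v ∈ S, 0 ≤ m v := by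
  have h : m ∈ dualMonoid (PointedCone.hull ℝ (toReal '' S)) ↔ PointedCone.hull ℝ (toReal '' S) ≤
      (PointedCone.positive ℝ ℝ).comap (m.baseChange ℝ) := Iff.rfl
  rw [h, Submodule.span_le, Set.image_subset_iff]
  simp [Set.subset_def]

end Cones

section Separation

variable {N : Type} [AddCommGroup N]

lemma exists_int_sum_mul_pos {ι κ : Type*} [Fintype ι] {T : Set κ} (hT : T.Finite) (t : κ → ι → ℝ)
    {c : ι → ℝ} (hc : ∀ x ∈ T, 0 < ∑ i, c i * t x i) :
    ∃ z : ι → ℤ, ∀ x ∈ T, 0 < ∑ i, z i * t x i := by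
  have hopen : IsOpen (⋂ x ∈ T, {c : ι → ℝ | 0 < ∑ i, c i * t x i}) :=
    hT.isOpen_biInter fun x _ => isOpen_lt continuous_const (by fun_prop)
  obtain ⟨q, hq⟩ := (DenseRange.piMap fun _ : ι => Rat.denseRange_cast (𝕜 := ℝ)).exists_mem_open
    hopen ⟨c, Set.mem_iInter₂.2 hc⟩
  obtain ⟨d, hd⟩ := IsLocalization.exist_integer_multiples (nonZeroDivisors ℤ) Finset.univ q
  choose z hz using fun i => hd i (Finset.mem_univ i)
  have hz' (i) : (z i : ℝ) = d * q i := by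
    have := hz i
    rw [zsmul_eq_mul] at this
    exact_mod_cast congrArg (Rat.cast (K := ℝ)) this
  have hd0 : (0 : ℝ) < (d : ℝ) ^ 2 := by
    have : (d : ℤ) ≠ 0 := nonZeroDivisors.ne_zero d.2
    positivity
  refine ⟨fun i => d * z i, fun x hx => ?_⟩
  have hpos : 0 < (d : ℝ) ^ 2 * ∑ i, (q i : ℝ) * t x i :=
    mul_pos hd0 (Set.mem_iInter₂.1 hq x hx)
  rw [Finset.mul_sum] at hpos
  convert hpos using 2 with i
  push_cast
  rw [hz']
  ring

lemma exists_dual_pos_of_zero_notMem_convexHull [Module.Free ℤ N] [Module.Finite ℤ N] {T : Set N}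
    (hT : T.Finite) (h : 0 ∉ convexHull ℝ (toReal '' T)) :
    ∃ m : Module.Dual ℤ N, ∀ t ∈ T, 0 < m t := by
  let e := Module.Free.chooseBasis ℤ N
  let E := (e.baseChange ℝ).equivFun
  have hE (t : N) (i) : E (toReal t) i = e.repr t i := by simp [E]
  have h0 : 0 ∉ convexHull ℝ ((E ∘ toReal) '' T) := by
    rw [Set.image_comp, ← LinearEquiv.coe_coe, ← LinearMap.image_convexHull]
    rintro ⟨y, hy, hy0⟩
    exact h (E.map_eq_zero_iff.1 hy0 ▸ hy)
  obtain ⟨f, u, hu, hf⟩ := geometric_hahn_banach_point_closed (convex_convexHull ℝ _)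
    ((hT.image _).isCompact_convexHull ℝ).isClosed h0
  rw [map_zero] at hu
  obtain ⟨z, hz⟩ := exists_int_sum_mul_pos hT (E ∘ toReal)
    (c := fun i => f fun j => if i = j then 1 else 0) fun t ht => by
      have := hu.trans (hf _ (subset_convexHull ℝ _ ⟨t, ht, rfl⟩))
      rw [← f.coe_coe, LinearMap.pi_apply_eq_sum_univ] at this
      simpa only [smul_eq_mul, mul_comm, f.coe_coe] using this
  refine ⟨∑ i, z i • e.coord i, fun t ht => ?_⟩
  have := hz t ht
  simp only [Function.comp_apply, hE] at this
  simp only [LinearMap.sum_apply, LinearMap.smul_apply, Module.Basis.coord_apply, smul_eq_mul]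
  exact_mod_cast this

lemma exists_dual_apply_eq_zero_and_pos [Module.Free ℤ N] [Module.Finite ℤ N] {v : N}
    {u : Module.Dual ℤ N} (huv : u v = 1) {T : Set N} (hT : T.Finite)
    (h : ∀ a : ℝ, a • toReal v ∉ convexHull ℝ (toReal '' T)) :
    ∃ m : Module.Dual ℤ N, m v = 0 ∧ ∀ t ∈ T, 0 < m t := by
  -- Separate in `N ⧸ ℤ v`, realised inside `N` as the image of the projection `p` along `v`.
  let p : N →ₗ[ℤ] N := LinearMap.id - u.smulRight v
  have hp (y : RealSpan N) : p.baseChange ℝ y = y - pair u y • toReal v := by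
    suffices p.baseChange ℝ = LinearMap.id - (u.baseChange ℝ).smulRight (toReal v) by
      rw [this]; rfl
    ext x
    simp [p, Int.cast_smul_eq_zsmul]
  obtain ⟨m, hm⟩ := exists_dual_pos_of_zero_notMem_convexHull (hT.image p) (by
    have himage : toReal '' (p '' T) = p.baseChange ℝ '' (toReal '' T) := by
      simp only [Set.image_image, toReal, LinearMap.baseChange_tmul]
    rw [himage, ← LinearMap.image_convexHull]
    rintro ⟨y, hy, hy0⟩
    rw [hp, sub_eq_zero] at hy0
    exact h _ (hy0 ▸ hy))
  exact ⟨m ∘ₗ p, by simp [p, huv], fun t ht => hm _ ⟨t, ht, rfl⟩⟩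

end Separation

section Rays

lemma exists_finset_span_image_eq_and_notMem {R M ι : Type*} [Semiring R] [AddCommMonoid M]
    [Module R M] (f : ι → M) (S : Finset ι) :
    ∃ T : Finset ι, Submodule.span R (f '' T) = Submodule.span R (f '' S) ∧
      ∀ t ∈ T, f t ∉ Submodule.span R (f '' (T \ {t} : Set ι)) := by
  classical
  obtain ⟨T, hT, hmin⟩ := exists_minimal_of_wellFoundedLT
    (fun T : Finset ι => Submodule.span R (f '' T) = Submodule.span R (f '' S)) ⟨S, rfl⟩
  refine ⟨T, hT, fun t ht hmem => ?_⟩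
  have herase : Submodule.span R (f '' (T.erase t)) = Submodule.span R (f '' S) := by
    rw [Finset.coe_erase, ← hT, ← Submodule.span_insert_eq_span hmem, ← Set.image_insert_eq,
      Set.insert_sdiff_singleton, Set.insert_eq_of_mem ht]
  exact Finset.notMem_erase t T (hmin herase (Finset.erase_subset t T) ht)

lemma convex_diff_zero_of_salient {E : Type*} [AddCommGroup E] [Module ℝ E] {C : PointedCone ℝ E}
    (hC : (C : ConvexCone ℝ E).Salient) : Convex ℝ (C \ {0} : Set E) := by
  rintro x ⟨hx, hx0⟩ y ⟨hy, hy0⟩ a b ha hb hab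
  refine ⟨C.convex hx hy ha hb hab, fun h => ?_⟩
  have hneg : -(a • x) = b • y := neg_eq_of_add_eq_zero_right h
  by_cases hax : a • x = 0
  · rw [hax, neg_zero, eq_comm] at hneg
    have ha0 := (smul_eq_zero.1 hax).resolve_right hx0
    have hb0 := (smul_eq_zero.1 hneg).resolve_right hy0
    exact zero_ne_one (by rw [← hab, ha0, hb0, add_zero])
  · exact hC _ (C.smul_mem ha hx) hax (hneg ▸ C.smul_mem hb hy)

lemma smul_notMem_convexHull_of_salient {E : Type*} [AddCommGroup E] [Module ℝ E]
    {C : PointedCone ℝ E} (hC : (C : ConvexCone ℝ E).Salient) {x : E} (hx : x ∈ C) {S : Set E}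
    (hS : S ⊆ C \ {0}) (hxS : x ∉ PointedCone.hull ℝ S) (a : ℝ) : a • x ∉ convexHull ℝ S := by
  intro hmem
  have hhull : a • x ∈ PointedCone.hull ℝ S :=
    convexHull_min PointedCone.subset_hull (PointedCone.hull ℝ S).convex hmem
  obtain ⟨hax, hax0⟩ := convexHull_min hS (convex_diff_zero_of_salient hC) hmem
  rcases lt_or_ge 0 a with ha | ha
  · exact hxS ((PointedCone.smul_mem_iff _ ha).1 hhull)
  · exact hC _ hax hax0 (by simpa using C.smul_mem (neg_nonneg.2 ha) hx)

variable {N : Type} [AddCommGroup N] {σ : PointedCone ℝ (RealSpan N)} {v : N}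

lemma hull_singleton_nsmul {d : ℕ} (hd : 0 < d) (v : N) :
    PointedCone.hull ℝ {toReal (d • v)} = PointedCone.hull ℝ {toReal v} := by
  rw [toReal_nsmul]
  exact Submodule.span_singleton_smul_eq (R := {c : ℝ // 0 ≤ c})
    (r := ⟨d, d.cast_nonneg⟩) (IsUnit.mk0 _ (by simp [hd.ne'])) _

lemma eq_zero_or_pair_pos_of_mem_hull {T : Set N} {m : Module.Dual ℤ N} (hm : ∀ t ∈ T, 0 < m t)
    {y : RealSpan N} (hy : y ∈ PointedCone.hull ℝ (toReal '' T)) : y = 0 ∨ 0 < pair m y := by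
  induction hy using Submodule.span_induction with
  | mem y hy =>
    obtain ⟨t, ht, rfl⟩ := hy
    exact .inr (by rw [pair_toReal]; exact_mod_cast hm t ht)
  | zero => exact .inl rfl
  | add x y _ _ hx hy =>
    rcases hx with rfl | hx
    · simpa using hy
    rcases hy with rfl | hy
    · simpa using Or.inr hx
    · exact .inr (by rw [pair, map_add]; exact add_pos hx hy)
  | smul a y _ hy =>
    rcases hy with rfl | hy
    · exact .inl (smul_zero a)
    rcases eq_or_ne a 0 with rfl | ha
    · exact .inl (zero_smul _ y)
    · refine .inr ?_
      change 0 < pair m (a.1 • y)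
      rw [pair, map_smul]
      exact mul_pos (a.2.lt_of_ne fun h => ha (Subtype.ext h.symm)) hy

lemma isFace_hull_singleton {T : Set N} {s : N} {m : Module.Dual ℤ N} (hs : m s = 0)
    (hT : ∀ t ∈ T, 0 < m t) :
    IsFace (PointedCone.hull ℝ {toReal s}) (PointedCone.hull ℝ (toReal '' insert s T)) := by
  have hle : PointedCone.hull ℝ {toReal s} ≤ PointedCone.hull ℝ (toReal '' insert s T) :=
    Submodule.span_mono (by simp)
  have hker (a : {c : ℝ // 0 ≤ c}) : pair m (a • toReal s) = 0 := by
    change pair m (a.1 • toReal s) = 0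
    rw [pair, map_smul, ← pair, pair_toReal, hs]; simp
  refine ⟨m, mem_dualMonoid_hull.2 ?_, fun x => ⟨fun hx => ⟨hle hx, ?_⟩, ?_⟩⟩
  · rintro t (rfl | ht)
    exacts [hs.ge, (hT t ht).le]
  · obtain ⟨a, rfl⟩ := Submodule.mem_span_singleton.1 hx
    exact hker a
  · rintro ⟨hx, hx0⟩
    rw [Set.image_insert_eq] at hx
    obtain ⟨a, z, hz, rfl⟩ := Submodule.mem_span_insert.1 hx
    have hz0 : pair m z = 0 := by rwa [pair, map_add, ← pair, hker, zero_add] at hx0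
    obtain rfl := (eq_zero_or_pair_pos_of_mem_hull hT hz).resolve_right hz0.not_gt
    rw [add_zero]
    exact Submodule.smul_mem _ a (Submodule.mem_span_singleton_self _)

lemma mem_rayGenerators_of_isFace [Module.Free ℤ N] {u : Module.Dual ℤ N} (huv : u v = 1)
    (hface : IsFace (PointedCone.hull ℝ {toReal v}) σ) : v ∈ rayGenerators σ := by
  refine ⟨fun hv => by simp [hv] at huv, hface, fun w hw => ?_⟩
  obtain ⟨⟨a, ha⟩, haw⟩ := Submodule.mem_span_singleton.1 hw
  replace haw : a • toReal v = toReal w := haw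
  have hau : a = u w := by
    simpa [huv] using congrArg (pair u) haw
  obtain ⟨k, hk⟩ := Int.eq_ofNat_of_zero_le (by exact_mod_cast hau ▸ ha : 0 ≤ u w)
  refine ⟨k, toReal_injective ?_⟩
  rw [← haw, hau, hk, toReal_nsmul]
  rfl

lemma toReal_mem_of_mem_rayGenerators (hv : v ∈ rayGenerators σ) : toReal v ∈ σ := by
  obtain ⟨-, ⟨m, -, hm⟩, -⟩ := hv
  exact ((hm _).1 (Submodule.mem_span_singleton_self _)).1

lemma exists_rayGenerator_of_notMem_hull [Module.Free ℤ N] [Module.Finite ℤ N] {S : Set N}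
    (hS : S.Finite) (hsal : (PointedCone.hull ℝ (toReal '' S) : ConvexCone ℝ (RealSpan N)).Salient)
    (h0 : 0 ∉ S) {s : N} (hs : s ∈ S) (hsS : toReal s ∉ PointedCone.hull ℝ (toReal '' (S \ {s}))) :
    ∃ v ∈ rayGenerators (PointedCone.hull ℝ (toReal '' S)), ∃ d : ℕ, s = d • v := by
  obtain ⟨v, u, d, hd, hsv, huv⟩ :=
    exists_eq_nsmul_and_dual_apply_eq_one (ne_of_mem_of_not_mem hs h0)
  have hmem {t : N} (ht : t ∈ S) : toReal t ∈ PointedCone.hull ℝ (toReal '' S) :=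
    PointedCone.subset_hull ⟨t, ht, rfl⟩
  obtain ⟨m, hmv, hmS⟩ := exists_dual_apply_eq_zero_and_pos huv (hS.sdiff (t := {s})) fun a => by
    have hv : toReal v = (d : ℝ)⁻¹ • toReal s := by
      rw [hsv, toReal_nsmul, inv_smul_smul₀ (by exact_mod_cast hd.ne')]
    rw [hv, smul_smul]
    refine smul_notMem_convexHull_of_salient hsal (hmem hs) ?_ hsS _
    rintro _ ⟨t, ht, rfl⟩
    refine ⟨hmem ht.1, fun h => h0 ?_⟩
    rw [← toReal_injective (h.trans (TensorProduct.tmul_zero N 1).symm)]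
    exact ht.1
  have hface := isFace_hull_singleton (s := s) (by rw [hsv, map_nsmul, hmv, smul_zero]) hmS
  rw [Set.insert_sdiff_singleton, Set.insert_eq_of_mem hs, hsv, hull_singleton_nsmul hd] at hface
  exact ⟨v, mem_rayGenerators_of_isFace huv hface, d, hsv⟩

lemma IsStronglyConvexRational.hull_rayGenerators [Module.Free ℤ N] [Module.Finite ℤ N]
    (hσ : IsStronglyConvexRational σ) : PointedCone.hull ℝ (toReal '' rayGenerators σ) = σ := by
  refine le_antisymm (Submodule.span_le.2 ?_) ?_
  · rintro _ ⟨v, hv, rfl⟩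
    exact toReal_mem_of_mem_rayGenerators hv
  -- Each member of an irredundant generating set is a multiple of a ray generator.
  obtain ⟨S, hS⟩ := hσ.rational
  obtain ⟨T, hT, hirr⟩ := exists_finset_span_image_eq_and_notMem (R := {c : ℝ // 0 ≤ c}) toReal S
  obtain rfl : σ = PointedCone.hull ℝ (toReal '' T) := hS.trans hT.symm
  refine Submodule.span_le.2 ?_
  rintro _ ⟨s, hs, rfl⟩
  obtain ⟨v, hv, d, hsv⟩ := exists_rayGenerator_of_notMem_hull T.finite_toSet hσ.salient
    (fun h0 => hirr 0 h0 (by simp)) hs (hirr s hs)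
  rw [hsv, toReal_nsmul]
  exact PointedCone.smul_mem _ d.cast_nonneg (PointedCone.subset_hull ⟨v, hv, rfl⟩)

lemma IsStronglyConvexRational.span_rayGenerators [Module.Free ℤ N] [Module.Finite ℤ N]
    (hσ : IsStronglyConvexRational σ) :
    Submodule.span ℝ (toReal '' rayGenerators σ) = Submodule.span ℝ σ := by
  conv_rhs => rw [← hσ.hull_rayGenerators]
  refine le_antisymm (Submodule.span_mono PointedCone.subset_hull) (Submodule.span_le.2 ?_)
  exact PointedCone.hull_le_span ℝ _

end Rays

section Vertices

lemma mem_vertices_of_mem_extremePoints {𝕜 E : Type*} [Field 𝕜] [LinearOrder 𝕜]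
    [IsStrictOrderedRing 𝕜] [AddCommGroup E] [Module 𝕜 E]
    {K : Geometry.SimplicialComplex 𝕜 E} {x : E} (hx : x ∈ K.space.extremePoints 𝕜) :
    x ∈ K.vertices := by
  obtain ⟨s, hs, hxs⟩ := Geometry.SimplicialComplex.mem_space_iff.1 hx.1
  have hmem : x ∈ s := extremePoints_convexHull_subset
    (inter_extremePoints_subset_extremePoints_of_subset
      (Geometry.SimplicialComplex.convexHull_subset_space hs) ⟨hxs, hx⟩)
  exact K.down_closed hs (Finset.singleton_subset_iff.2 hmem) (Finset.singleton_nonempty x)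

variable {N : Type} [AddCommGroup N] {σ : PointedCone ℝ (RealSpan N)}

lemma rayPolytope_subset : rayPolytope σ ⊆ σ := by
  refine convexHull_min ?_ σ.convex
  rintro _ ⟨v, hv, rfl⟩
  exact toReal_mem_of_mem_rayGenerators hv

lemma pair_eq_one_of_mem_rayPolytope {m₀ : Module.Dual ℤ N}
    (hm₀ : ∀ v ∈ rayGenerators σ, m₀ v = 1) {x : RealSpan N} (hx : x ∈ rayPolytope σ) :
    pair m₀ x = 1 := by
  refine convexHull_min ?_ (convex_hyperplane (m₀.baseChange ℝ).isLinear 1) hx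
  rintro _ ⟨v, hv, rfl⟩
  exact (pair_toReal m₀ v).trans (by rw [hm₀ v hv, Int.cast_one])

lemma toReal_mem_extremePoints_rayPolytope {m₀ : Module.Dual ℤ N}
    (hm₀ : ∀ v ∈ rayGenerators σ, m₀ v = 1) {v : N} (hv : v ∈ rayGenerators σ) :
    toReal v ∈ (rayPolytope σ).extremePoints ℝ := by
  refine mem_extremePoints_iff_left.2 ⟨subset_convexHull ℝ _ ⟨v, hv, rfl⟩, ?_⟩
  rintro x hx y hy ⟨a, b, ha, hb, -, hxy⟩
  obtain ⟨m, hm, hface⟩ := hv.2.1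
  have hv0 := ((hface _).1 (Submodule.mem_span_singleton_self _)).2
  rw [← hxy, pair, map_add, map_smul, map_smul, smul_eq_mul, smul_eq_mul] at hv0
  have hx0 : pair m x = 0 := by
    have hmx : 0 ≤ pair m x := hm x (rayPolytope_subset hx)
    have hmy : 0 ≤ pair m y := hm y (rayPolytope_subset hy)
    have hax := ((add_eq_zero_iff_of_nonneg (mul_nonneg ha.le hmx) (mul_nonneg hb.le hmy)).1 hv0).1
    exact (mul_eq_zero.1 hax).resolve_left ha.ne'
  obtain ⟨c, rfl⟩ := Submodule.mem_span_singleton.1 ((hface x).2 ⟨rayPolytope_subset hx, hx0⟩)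
  have hc : c.1 * pair m₀ (toReal v) = 1 :=
    (map_smul (m₀.baseChange ℝ) c.1 (toReal v)).symm.trans (pair_eq_one_of_mem_rayPolytope hm₀ hx)
  rw [pair_toReal, hm₀ v hv, Int.cast_one, mul_one] at hc
  rw [show c = 1 from Subtype.ext hc]
  exact one_smul ℝ (toReal v)

lemma Fan.IsConeOver.hull_mem_cones {Δ : Fan N} {K : Geometry.SimplicialComplex ℝ (RealSpan N)}
    (hΔ : Δ.IsConeOver K) {x : RealSpan N} (hx : x ∈ K.vertices) :
    PointedCone.hull ℝ {x} ∈ Δ.cones := by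
  rw [show Δ.cones = _ from hΔ]
  exact .inr ⟨{x}, hx, by rw [Finset.coe_singleton]⟩

end Vertices

section Units

lemma card_support_mul_card_support_le_one {R A : Type*} [Semiring R] [NoZeroDivisors R] [Add A]
    [TwoUniqueSums A] {g h : AddMonoidAlgebra R A} {a : A} {r : R}
    (hgh : g * h = AddMonoidAlgebra.single a r) :
    g.coeff.support.card * h.coeff.support.card ≤ 1 := by
  by_contra! hcard
  obtain ⟨p, hp, q, hq, hpq, hup, huq⟩ := TwoUniqueSums.uniqueAdd_of_one_lt_card hcard
  have hsum {s : A × A} (hs : s ∈ g.coeff.support ×ˢ h.coeff.support)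
      (hus : UniqueAdd g.coeff.support h.coeff.support s.1 s.2) : s.1 + s.2 = a := by
    classical
    rw [Finset.mem_product, Finsupp.mem_support_iff, Finsupp.mem_support_iff] at hs
    have hcoeff := AddMonoidAlgebra.coeff_mul_add_of_uniqueAdd hus
    rw [hgh, AddMonoidAlgebra.coeff_single, Finsupp.single_apply] at hcoeff
    by_contra hne
    rw [if_neg (Ne.symm hne)] at hcoeff
    exact mul_ne_zero hs.1 hs.2 hcoeff.symm
  obtain ⟨hq₁, hq₂⟩ := Finset.mem_product.1 hq
  obtain ⟨h₁, h₂⟩ := hup hq₁ hq₂ ((hsum hq huq).trans (hsum hp hup).symm)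
  exact hpq (Prod.ext h₁.symm h₂.symm)

lemma exists_eq_single_of_isUnit {R A : Type*} [CommSemiring R] [NoZeroDivisors R] [Nontrivial R]
    [AddCommMonoid A] [TwoUniqueSums A] {g : AddMonoidAlgebra R A} (hg : IsUnit g) :
    ∃ (k : A) (c : R), IsAddUnit k ∧ c ≠ 0 ∧ g = AddMonoidAlgebra.single k c := by
  obtain ⟨h, hgh⟩ := hg.exists_right_inv
  have hcard : g.coeff.support.card * h.coeff.support.card = 1 := by
    refine (card_support_mul_card_support_le_one hgh).antisymm (Nat.mul_pos ?_ ?_) <;>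
      rw [Finset.card_pos, Finsupp.support_nonempty_iff, ← AddMonoidAlgebra.coeff_zero,
        AddMonoidAlgebra.coeff_injective.ne_iff]
    exacts [left_ne_zero_of_mul_eq_one hgh, right_ne_zero_of_mul_eq_one hgh]
  obtain ⟨hg₁, hh₁⟩ := mul_eq_one.1 hcard
  obtain ⟨k, c, hc, hk⟩ := Finsupp.card_support_eq_one'.1 hg₁
  obtain ⟨l, d, hd, hl⟩ := Finsupp.card_support_eq_one'.1 hh₁
  obtain rfl : g = AddMonoidAlgebra.single k c := AddMonoidAlgebra.coeff_injective <| by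
    rw [hk, AddMonoidAlgebra.coeff_single]
  obtain rfl : h = AddMonoidAlgebra.single l d := AddMonoidAlgebra.coeff_injective <| by
    rw [hl, AddMonoidAlgebra.coeff_single]
  rw [AddMonoidAlgebra.single_mul_single, AddMonoidAlgebra.one_def,
    AddMonoidAlgebra.single_inj] at hgh
  have hkl : k + l = 0 := (hgh.resolve_right fun h => mul_ne_zero hc hd h.1).1
  exact ⟨k, c, IsAddUnit.of_add_eq_zero l hkl, hc, rfl⟩

variable {N : Type} [AddCommGroup N]

instance [Module.Free ℤ N] (τ : PointedCone ℝ (RealSpan N)) : TwoUniqueSums (dualMonoid τ) :=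
  let e := Module.Free.chooseBasis ℤ N
  TwoUniqueSums.of_injective_addHom
    ((e.constr ℤ).symm.toAddEquiv.toAddMonoidHom.comp (dualMonoid τ).subtype).toAddHom
    ((e.constr ℤ).symm.injective.comp Subtype.val_injective) inferInstance

end Units

section Forms

lemma exteriorPower_span_ιMulti_singleton {n : ℕ} {R M : Type*} [CommRing R] [AddCommGroup M]
    [Module R M] {v : Fin n → M} (hv : Submodule.span R (Set.range v) = ⊤) :
    Submodule.span R {exteriorPower.ιMulti R n v} = ⊤ := by
  rw [eq_top_iff, ← exteriorPower.ιMulti_family_span_of_span R hv]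
  refine Submodule.span_mono ?_
  rintro _ ⟨f, rfl⟩
  have hf (g : Fin n ↪o Fin n) : ⇑g = id := (g.strictMono.range_inj strictMono_id).1 <| by
    rw [(Finite.injective_iff_surjective.1 g.injective).range_eq, Set.range_id]
  rw [Set.mem_singleton_iff, exteriorPower.ιMulti_family, hf, Function.comp_id]

lemma isUnit_of_one_tmul_smul_ne_zero {R M : Type*} [CommRing R] [AddCommGroup M] [Module R M]
    {g : R} {w : M}
    (h : ∀ p : PrimeSpectrum R, (1 : p.asIdeal.ResidueField) ⊗ₜ[R] (g • w) ≠ 0) : IsUnit g := by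
  by_contra hg
  obtain ⟨P, hP, hgP⟩ := exists_max_ideal_of_mem_nonunits hg
  refine h ⟨P, hP.isPrime⟩ ?_
  rw [← TensorProduct.smul_tmul, Algebra.smul_def,
    Ideal.algebraMap_residueField_eq_zero.2 hgP, zero_mul, TensorProduct.zero_tmul]

variable {n : ℕ} {A B : Type} [CommRing A] [CommRing B] [Algebra ℂ A] [Algebra ℂ B]

lemma exists_isUnit_smul_wedgeD {f : Fin n → A}
    (hf : Submodule.span A (Set.range fun i => KaehlerDifferential.D ℂ A (f i)) = ⊤)
    {ω : AlgForm n A} (hω : ∀ p : PrimeSpectrum A, (1 : p.asIdeal.ResidueField) ⊗ₜ[A] ω ≠ 0) :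
    ∃ g : A, IsUnit g ∧ ω = g • wedgeD f := by
  obtain ⟨g, rfl⟩ := Submodule.mem_span_singleton.1
    (exteriorPower_span_ιMulti_singleton hf ▸ Submodule.mem_top : ω ∈ Submodule.span A {wedgeD f})
  exact ⟨g, isUnit_of_one_tmul_smul_ne_zero hω, rfl⟩

lemma span_D_comp_of_surjective {ι : Type*} {φ : A →ₐ[ℂ] B} (hφ : Function.Surjective φ)
    {f : ι → A}
    (hf : Submodule.span A (Set.range fun i => KaehlerDifferential.D ℂ A (f i)) = ⊤) :
    Submodule.span B (Set.range fun i => KaehlerDifferential.D ℂ B (φ (f i))) = ⊤ := by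
  let : Algebra A B := φ.toRingHom.toAlgebra
  have : IsScalarTower ℂ A B := IsScalarTower.of_algebraMap_eq fun x => (φ.commutes x).symm
  set W := Submodule.span B (Set.range fun i => KaehlerDifferential.D ℂ B (φ (f i)))
  have hW : (⊤ : Submodule A (Ω[A⁄ℂ])) ≤
      (W.restrictScalars A).comap (KaehlerDifferential.map ℂ ℂ A B) := by
    rw [← hf, Submodule.span_le]
    rintro _ ⟨i, rfl⟩
    change KaehlerDifferential.map ℂ ℂ A B _ ∈ W
    rw [KaehlerDifferential.map_D]
    exact Submodule.subset_span ⟨i, rfl⟩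
  refine eq_top_iff.2 fun y _ => ?_
  obtain ⟨x, rfl⟩ := KaehlerDifferential.map_surjective_of_surjective ℂ ℂ A B hφ y
  exact hW Submodule.mem_top

lemma AlgForm.map_smul_wedgeD (φ : A →ₐ[ℂ] B) (g : A) (f : Fin n → A) :
    AlgForm.map n φ (g • wedgeD f) = φ g • wedgeD fun i => φ (f i) := by
  let : Algebra A B := φ.toRingHom.toAlgebra
  have : IsScalarTower ℂ A B := IsScalarTower.of_algebraMap_eq fun x => (φ.commutes x).symm
  simp only [AlgForm.map, wedgeD, LinearMap.toAddMonoidHom_coe]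
  rw [map_smul, exteriorPower.alternatingMapLinearEquiv_apply_ιMulti, ← algebraMap_smul B g]
  change φ g • exteriorPower.ιMulti B n (fun i => KaehlerDifferential.map ℂ ℂ A B _) = _
  simp only [KaehlerDifferential.map_D]
  rfl

/-- The contraction `Ω^n → A` of `n`-forms with `n` vector fields, that is, with `n` derivations
of `A`. -/
def contraction (d : Fin n → Derivation ℂ A A) : AlgForm n A →ₗ[A] A :=
  exteriorPower.alternatingMapLinearEquiv (Matrix.detRowAlternating.compLinearMap
    (LinearMap.pi fun j => (d j).liftKaehlerDifferential))

lemma contraction_wedgeD (d : Fin n → Derivation ℂ A A) (f : Fin n → A) :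
    contraction d (wedgeD f) = (Matrix.of fun i j => d j (f i)).det := by
  rw [contraction, wedgeD, exteriorPower.alternatingMapLinearEquiv_apply_ιMulti]
  change Matrix.det _ = _
  congr 1
  ext i j
  exact Derivation.liftKaehlerDifferential_comp_D _ _

lemma contraction_wedgeD_of_apply_eq_smul {d : Fin n → Derivation ℂ A A} {f : Fin n → A}
    {x : Matrix (Fin n) (Fin n) ℤ} (h : ∀ i j, d j (f i) = (x i j : ℂ) • f i) :
    contraction d (wedgeD f) = (x.det : ℂ) • ∏ i, f i := by
  have hx : algebraMap ℂ A x.det = (x.map fun z => algebraMap ℂ A z).det := by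
    rw [Int.cast_det, RingHom.map_det]
    rfl
  rw [contraction_wedgeD, Algebra.smul_def, mul_comm, hx, ← Matrix.det_mul_column]
  simp only [h, Algebra.smul_def, mul_comm, Matrix.map_apply]

section Weights

variable {R M : Type*} [CommRing R] [AddCommMonoid M] (φ : M →+ R)

/-- The linear map `χ^m ↦ φ(m) χ^m` on a monoid algebra. -/
def weightMap : AddMonoidAlgebra R M →ₗ[R] AddMonoidAlgebra R M :=
  (Finsupp.lsum R fun m => φ m • AddMonoidAlgebra.lsingle (R := R) (S := R) m).comp
    (AddMonoidAlgebra.coeffLinearEquiv R).toLinearMap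

lemma weightMap_single (m : M) (c : R) :
    weightMap φ (AddMonoidAlgebra.single m c) = φ m • AddMonoidAlgebra.single m c := by
  simp [weightMap]

/-- `weightMap φ` as a derivation. On the ring of a torus these are the invariant vector fields. -/
def weightDerivation : Derivation R (AddMonoidAlgebra R M) (AddMonoidAlgebra R M) :=
  Derivation.mk' (weightMap φ) fun f g => by
    induction f using AddMonoidAlgebra.induction_linear with
    | zero => simp
    | add f₁ f₂ h₁ h₂ => simp only [add_mul, map_add, h₁, h₂, smul_eq_mul]; ring
    | single m c =>
      induction g using AddMonoidAlgebra.induction_linear with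
      | zero => simp
      | add f₁ f₂ h₁ h₂ => simp only [mul_add, map_add, h₁, h₂, smul_eq_mul]; ring
      | single m' c' =>
        simp only [smul_eq_mul, weightMap_single, AddMonoidAlgebra.single_mul_single, map_add,
          mul_smul_comm, add_smul, add_comm m' m, mul_comm c' c]
        exact add_comm _ _

end Weights

end Forms

section Characters

variable {N : Type} [AddCommGroup N] {τ : PointedCone ℝ (RealSpan N)}

lemma chi_add (m m' : dualMonoid τ) : chi (m + m') = chi m * chi m' := by
  rw [AddMonoidAlgebra.single_mul_single, mul_one]

lemma chi_sum {ι : Type*} (s : Finset ι) (u : ι → dualMonoid τ) :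
    chi (∑ i ∈ s, u i) = ∏ i ∈ s, chi (u i) := by
  classical
  induction s using Finset.induction_on with
  | empty => rw [Finset.sum_empty, Finset.prod_empty, AddMonoidAlgebra.one_def]
  | insert i s hi ih => rw [Finset.sum_insert hi, Finset.prod_insert hi, chi_add, ih]

/-- The invariant vector field `χ^m ↦ ⟨m, v⟩ χ^m` belonging to `v ∈ N`. -/
def invariantDerivation (v : N) : Derivation ℂ (CoordRing τ) (CoordRing τ) :=
  weightDerivation ((Int.castAddHom ℂ).comp
    ((Module.Dual.eval ℤ N v).toAddMonoidHom.comp (dualMonoid τ).subtype))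

lemma invariantDerivation_chi (v : N) (m : dualMonoid τ) :
    invariantDerivation v (chi m) = (m.1 v : ℂ) • chi m :=
  weightMap_single _ m 1

lemma contraction_invariantDerivation_wedgeD_chi {n : ℕ} (w : Fin n → N)
    (u : Fin n → dualMonoid τ) :
    contraction (fun j => invariantDerivation (w j)) (wedgeD fun i => chi (u i)) =
      ((Matrix.of fun i j => (u i).1 (w j)).det : ℂ) • chi (∑ i, u i) := by
  rw [contraction_wedgeD_of_apply_eq_smul fun i j => invariantDerivation_chi (w j) (u i), chi_sum]
  rfl

lemma add_sum_eq_of_smul_wedgeD_chi_eq {n : ℕ} {e : Module.Basis (Fin n) ℤ N}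
    {u u' : Fin n → dualMonoid τ} (hu : ∀ i, (u i).1 = e.coord i) {k l : dualMonoid τ} {c d : ℂ}
    (hc : c ≠ 0) (h : (c • chi k) • wedgeD (fun i => chi (u i)) =
      (d • chi l) • wedgeD fun i => chi (u' i)) :
    k + ∑ i, u i = l + ∑ i, u' i := by
  have hdet : (Matrix.of fun i j => (u i).1 (e j)).det = 1 := by
    convert Matrix.det_one (n := Fin n) (R := ℤ)
    ext i j
    simp [hu, Matrix.one_apply, Finsupp.single_apply, eq_comm]
  have hcontr := congrArg (contraction fun j => invariantDerivation (e j)) h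
  simp only [map_smul, contraction_invariantDerivation_wedgeD_chi, hdet, smul_eq_mul,
    AddMonoidAlgebra.single_mul_single, AddMonoidAlgebra.smul_single, mul_one,
    Int.cast_one] at hcontr
  exact ((AddMonoidAlgebra.single_inj.1 hcontr).resolve_right fun h => hc h.1).1

section Coordinates

variable {ι : Type*} {b : Module.Basis ι ℤ N} {J : Set ι}
  (hτ : τ = PointedCone.hull ℝ (toReal '' (b '' J)))

include hτ

lemma zsmul_coord_mem_dualMonoid {i : ι} {z : ℤ} (hz : i ∈ J → 0 ≤ z) :
    z • b.coord i ∈ dualMonoid τ := by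
  rw [hτ, mem_dualMonoid_hull]
  rintro _ ⟨j, hj, rfl⟩
  classical
  rw [LinearMap.smul_apply, Module.Basis.coord_apply, b.repr_self, Finsupp.single_apply]
  split_ifs with h
  · simpa using hz (h ▸ hj)
  · simp

lemma coord_mem_dualMonoid (i : ι) : b.coord i ∈ dualMonoid τ := by
  simpa using zsmul_coord_mem_dualMonoid hτ (i := i) fun _ => zero_le_one

lemma apply_nonneg_of_mem_dualMonoid {m : Module.Dual ℤ N} (hm : m ∈ dualMonoid τ) {j : ι}
    (hj : j ∈ J) : 0 ≤ m (b j) := by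
  rw [hτ, mem_dualMonoid_hull] at hm
  exact hm _ ⟨j, hj, rfl⟩

variable {Q : Type*} [AddCommGroup Q] [Module ℂ Q] [Module (CoordRing τ) Q]
  {d : Derivation ℂ (CoordRing τ) Q}

lemma derivation_chi_zsmul_coord_eq_zero (i : ι)
    (hd : d (chi ⟨b.coord i, coord_mem_dualMonoid hτ i⟩) = 0) {z : ℤ} (hz : i ∈ J → 0 ≤ z) :
    d (chi ⟨z • b.coord i, zsmul_coord_mem_dualMonoid hτ hz⟩) = 0 := by
  have hpow (k : ℕ) :
      d (chi (k • (⟨b.coord i, coord_mem_dualMonoid hτ i⟩ : dualMonoid τ))) = 0 := by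
    rw [← chi_pow, Derivation.leibniz_pow, hd, smul_zero, smul_zero]
  obtain ⟨k, rfl | rfl⟩ := z.eq_nat_or_neg
  · convert hpow k using 3
    exact Subtype.ext (natCast_zsmul _ _)
  · have hinv : chi ⟨-(k : ℤ) • b.coord i, zsmul_coord_mem_dualMonoid hτ hz⟩ *
        chi (k • (⟨b.coord i, coord_mem_dualMonoid hτ i⟩ : dualMonoid τ)) = 1 := by
      rw [← chi_add, AddMonoidAlgebra.one_def]
      congr 1
      exact Subtype.ext (by simp)
    rw [Derivation.leibniz_of_mul_eq_one _ hinv, hpow, smul_zero]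

lemma derivation_eq_zero_of_apply_chi_coord [Finite ι]
    (hd : ∀ i, d (chi ⟨b.coord i, coord_mem_dualMonoid hτ i⟩) = 0) : d = 0 := by
  cases nonempty_fintype ι
  have hchi (m : dualMonoid τ) : d (chi m) = 0 := by
    have hm {i : ι} : i ∈ J → 0 ≤ m.1 (b i) := apply_nonneg_of_mem_dualMonoid hτ m.2
    have hsum : m = ∑ i, ⟨m.1 (b i) • b.coord i, zsmul_coord_mem_dualMonoid hτ hm⟩ :=
      Subtype.ext (by simp)
    rw [hsum]
    refine Finset.sum_induction _ (fun m => d (chi m) = 0) (fun m m' h h' => ?_) ?_ fun i _ =>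
      derivation_chi_zsmul_coord_eq_zero hτ i (hd i) hm
    · rw [chi_add, d.leibniz, h, h', smul_zero, smul_zero, add_zero]
    · exact d.map_one_eq_zero
  ext x
  induction x using AddMonoidAlgebra.induction_linear with
  | zero => rw [map_zero, map_zero]
  | add f g hf hg => rw [map_add, map_add, hf, hg]
  | single m c =>
    rw [← mul_one c, ← smul_eq_mul, ← AddMonoidAlgebra.smul_single, d.map_smul, hchi, smul_zero]
    rfl

lemma span_D_chi_coord [Finite ι] :
    Submodule.span (CoordRing τ) (Set.range fun i => KaehlerDifferential.D ℂ (CoordRing τ)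
      (chi ⟨b.coord i, coord_mem_dualMonoid hτ i⟩)) = ⊤ := by
  set W := Submodule.span (CoordRing τ) (Set.range fun i => KaehlerDifferential.D ℂ (CoordRing τ)
      (chi ⟨b.coord i, coord_mem_dualMonoid hτ i⟩))
  have hD : W.mkQ.compDer (KaehlerDifferential.D ℂ (CoordRing τ)) = 0 :=
    derivation_eq_zero_of_apply_chi_coord hτ fun i =>
      (Submodule.Quotient.mk_eq_zero W).2 (Submodule.subset_span ⟨i, rfl⟩)
  rw [eq_top_iff, ← KaehlerDifferential.span_range_derivation, Submodule.span_le]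
  rintro _ ⟨x, rfl⟩
  exact (Submodule.Quotient.mk_eq_zero W).1 (DFunLike.congr_fun hD x)

end Coordinates

end Characters

section Schemes

lemma appLE_Spec_map_top {R S : CommRingCat.{0}} (φ : R ⟶ S) (e : ⊤ ≤ Spec.map φ ⁻¹ᵁ ⊤) :
    (Spec.map φ).appLE ⊤ ⊤ e ≫ (Scheme.ΓSpecIso S).hom = (Scheme.ΓSpecIso R).hom ≫ φ := by
  have h : (Spec.map φ).appLE ⊤ ⊤ e = (Spec.map φ).appTop := Scheme.Hom.appLE_eq_app _
  rw [h, Scheme.ΓSpecIso_naturality]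

lemma appLE_congr_hom {X Y : Scheme.{0}} {f g : X ⟶ Y} (h : f = g) (U : Y.Opens) (V : X.Opens)
    (e : V ≤ f ⁻¹ᵁ U) : f.appLE U V e = g.appLE U V (h ▸ e) := by
  subst h; rfl

lemma appLE_appLE_ΓSpecIso {Y : Scheme.{0}} {R A : CommRingCat.{0}} (g : Y ⟶ Spec R)
    (f : Spec A ⟶ Y) (φ : R ⟶ A) (h : f ≫ g = Spec.map φ) (U : Y.Opens) (e₁ : U ≤ g ⁻¹ᵁ ⊤)
    (e : ⊤ ≤ f ⁻¹ᵁ U) :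
    ((Scheme.ΓSpecIso R).inv ≫ g.appLE ⊤ U e₁) ≫ f.appLE U ⊤ e ≫ (Scheme.ΓSpecIso A).hom = φ := by
  rw [Category.assoc, Scheme.Hom.appLE_comp_appLE_assoc, appLE_congr_hom h, appLE_Spec_map_top,
    Iso.inv_hom_id_assoc]

lemma map_appLE_ΓSpecIso {Y : Scheme.{0}} {A B : CommRingCat.{0}} (f : Spec A ⟶ Y)
    (f' : Spec B ⟶ Y) (φ : A ⟶ B) (h : Spec.map φ ≫ f = f') {U V : Y.Opens} (i : V ≤ U)
    (e : ⊤ ≤ f ⁻¹ᵁ U) (e' : ⊤ ≤ f' ⁻¹ᵁ V) :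
    Y.presheaf.map (homOfLE i).op ≫ f'.appLE V ⊤ e' ≫ (Scheme.ΓSpecIso B).hom =
      (f.appLE U ⊤ e ≫ (Scheme.ΓSpecIso A).hom) ≫ φ := by
  have e'' : ⊤ ≤ Spec.map φ ⁻¹ᵁ ⊤ := le_top
  rw [Scheme.Hom.map_appLE_assoc, Category.assoc, ← appLE_Spec_map_top φ e'',
    Scheme.Hom.appLE_comp_appLE_assoc, appLE_congr_hom h]

end Schemes

section Charts

variable {N : Type} [AddCommGroup N] (Δ : Fan N)

/-- The affine open subset of `Y_Δ` belonging to a cone. -/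
def Fan.chartOpen (τ : Δ.cones) : Δ.toricVariety.left.affineOpens :=
  ⟨Δ.chart τ ''ᵁ ⊤, (isAffineOpen_top _).image_of_isOpenImmersion _⟩

lemma Fan.diagram_map_chart {τ σ : Δ.cones} (f : τ ⟶ σ) :
    Δ.diagram.map f ≫ Δ.chart σ = Δ.chart τ :=
  colimit.w Δ.diagram f

lemma Fan.chart_hom (τ : Δ.cones) :
    Δ.chart τ ≫ Δ.toricVariety.hom =
      Spec.map (CommRingCat.ofHom (algebraMap ℂ (CoordRing τ.1))) :=
  colimit.ι_desc Δ.diagramCocone τ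

/-- The regular functions on the chart of a cone. -/
def Fan.sectionsIso (τ : Δ.cones) :
    Γ(Δ.toricVariety.left, (Δ.chartOpen τ).1) ≅ CommRingCat.of (CoordRing τ.1) :=
  (Δ.chart τ).appIso ⊤ ≪≫ Scheme.ΓSpecIso _

lemma Fan.sectionsIso_hom (τ : Δ.cones) : (Δ.sectionsIso τ).hom =
    (Δ.chart τ).appLE (Δ.chartOpen τ).1 ⊤ ((Δ.chart τ).preimage_image_eq ⊤).ge ≫
      (Scheme.ΓSpecIso _).hom := by
  change ((Δ.chart τ).appIso ⊤).hom ≫ _ = _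
  rw [Scheme.Hom.appIso_hom']
  rfl

lemma Fan.algebraMap_sectionsIso (τ : Δ.cones) (c : ℂ) :
    (Δ.sectionsIso τ).hom (algebraMap ℂ Γ(Δ.toricVariety.left, (Δ.chartOpen τ).1) c) =
      algebraMap ℂ (CoordRing τ.1) c := by
  have h : ((Scheme.ΓSpecIso (CommRingCat.of ℂ)).inv ≫ Δ.toricVariety.hom.appLE ⊤
      (Δ.chartOpen τ).1 (le_preimage_top _ _)) ≫ (Δ.sectionsIso τ).hom =
        CommRingCat.ofHom (algebraMap ℂ (CoordRing τ.1)) := by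
    rw [Fan.sectionsIso_hom]
    exact appLE_appLE_ΓSpecIso _ _ _ (Δ.chart_hom τ) _ _ _
  exact congrArg (fun φ => φ.hom c) h

/-- The regular functions on the chart of a cone, as a `ℂ`-algebra. -/
def Fan.sectionsEquiv (τ : Δ.cones) :
    Γ(Δ.toricVariety.left, (Δ.chartOpen τ).1) ≃ₐ[ℂ] CoordRing τ.1 :=
  AlgEquiv.ofRingEquiv (f := (Δ.sectionsIso τ).commRingCatIsoToRingEquiv)
    (Δ.algebraMap_sectionsIso τ)

lemma Fan.chartOpen_mono {τ σ : Δ.cones} (h : τ ≤ σ) :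
    (Δ.chartOpen τ).1 ≤ (Δ.chartOpen σ).1 := by
  rintro _ ⟨x, -, rfl⟩
  refine ⟨Δ.diagram.map (homOfLE h) x, trivial, ?_⟩
  have := congrArg (fun f : Spec (CommRingCat.of (CoordRing τ.1)) ⟶ Δ.toricVariety.left => f x)
    (Δ.diagram_map_chart (homOfLE h))
  exact (Scheme.Hom.comp_apply _ _ x).symm.trans this

lemma Fan.sectionsEquiv_res {τ σ : Δ.cones} (h : τ ≤ σ)
    (x : Γ(Δ.toricVariety.left, (Δ.chartOpen σ).1)) :
    Δ.sectionsEquiv τ (resAlgHom Δ.toricVariety (Δ.chartOpen_mono h) x) =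
      coordMap h (Δ.sectionsEquiv σ x) := by
  have hres : Δ.toricVariety.left.presheaf.map (homOfLE (Δ.chartOpen_mono h)).op ≫
      (Δ.sectionsIso τ).hom = (Δ.sectionsIso σ).hom ≫
        CommRingCat.ofHom (coordMap h).toRingHom := by
    rw [Fan.sectionsIso_hom, Fan.sectionsIso_hom]
    exact map_appLE_ΓSpecIso _ _ _ (Δ.diagram_map_chart (homOfLE h)) _ _ _
  exact congrArg (fun φ => φ.hom x) hres

/-- The regular functions on the torus, as a `ℂ`-algebra. The torus is by definition the chart of
the cone `{0}`. -/
def Fan.torusEquiv : Γ(Δ.toricVariety.left, Δ.torus.1) ≃ₐ[ℂ] CoordRing Δ.zeroCone.1 :=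
  Δ.sectionsEquiv Δ.zeroCone

lemma Fan.torusEquiv_character (m : Module.Dual ℤ N) :
    Δ.torusEquiv (Δ.character m) = chi ⟨m, mem_dualMonoid_bot m⟩ :=
  (Δ.sectionsEquiv Δ.zeroCone).apply_symm_apply _

lemma Fan.character_zero : Δ.character 0 = 1 :=
  map_one Δ.torusEquiv.symm

lemma Fan.zeroCone_le (τ : Δ.cones) : Δ.zeroCone ≤ τ :=
  bot_le (a := τ.1)

lemma Fan.torus_le_chartOpen (τ : Δ.cones) : Δ.torus.1 ≤ (Δ.chartOpen τ).1 :=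
  Δ.chartOpen_mono (Δ.zeroCone_le τ)

lemma Fan.res_torus_sectionsEquiv_symm_chi (τ : Δ.cones) (m : dualMonoid τ.1) :
    resAlgHom Δ.toricVariety (Δ.torus_le_chartOpen τ) ((Δ.sectionsEquiv τ).symm (chi m)) =
      Δ.character m.1 := by
  have hres := Δ.sectionsEquiv_res (Δ.zeroCone_le τ) ((Δ.sectionsEquiv τ).symm (chi m))
  rw [AlgEquiv.apply_symm_apply, coordMap_chi] at hres
  exact Δ.torusEquiv.injective (hres.trans (Δ.torusEquiv_character m.1).symm)

end Charts

section Torus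

variable {N : Type} [AddCommGroup N] {Δ : Fan N} {n : ℕ}

lemma RegularForm.exists_form_torus_eq (Ω : RegularForm Δ.toricVariety n)
    (hΩ : Ω.NowhereVanishing) (b : Module.Basis (Fin n) ℤ N) {J : Set (Fin n)} {τ : Δ.cones}
    (hτ : τ.1 = PointedCone.hull ℝ (toReal '' (b '' J))) :
    ∃ (k : Module.Dual ℤ N) (c : ℂ), c ≠ 0 ∧ (∀ j ∈ J, k (b j) = 0) ∧
      Ω.form Δ.torus = (c • Δ.character k) • wedgeD fun i => Δ.character (b.coord i) := by
  have := Module.Free.of_basis b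
  obtain ⟨a, ha, hform⟩ := exists_isUnit_smul_wedgeD (span_D_comp_of_surjective
    (φ := (Δ.sectionsEquiv τ).symm.toAlgHom) (Δ.sectionsEquiv τ).symm.surjective
    (span_D_chi_coord hτ)) (hΩ (Δ.chartOpen τ))
  obtain ⟨k, c, hk, hc, hkc⟩ := exists_eq_single_of_isUnit (ha.map (Δ.sectionsEquiv τ))
  obtain ⟨l, hkl⟩ := hk.exists_neg
  refine ⟨k, c, hc, fun j hj => ?_, ?_⟩
  · have hsum : k.1 (b j) + l.1 (b j) = 0 := congrArg (fun m : dualMonoid τ.1 => m.1 (b j)) hkl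
    exact ((add_eq_zero_iff_of_nonneg (apply_nonneg_of_mem_dualMonoid hτ k.2 hj)
      (apply_nonneg_of_mem_dualMonoid hτ l.2 hj)).1 hsum).1
  · have ha' : a = c • (Δ.sectionsEquiv τ).symm (chi k) := by
      rw [← map_smul, AddMonoidAlgebra.smul_single, smul_eq_mul, mul_one, ← hkc,
        AlgEquiv.symm_apply_apply]
    rw [← Ω.res _ _ (Δ.torus_le_chartOpen τ), hform, AlgForm.map_smul_wedgeD, ha', map_smul,
      Δ.res_torus_sectionsEquiv_symm_chi]
    simp only [AlgEquiv.coe_toAlgHom, Δ.res_torus_sectionsEquiv_symm_chi]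

lemma Fan.add_sum_coord_eq_of_smul_wedgeD_eq {e b : Module.Basis (Fin n) ℤ N}
    {k l : Module.Dual ℤ N} {c d : ℂ} (hc : c ≠ 0)
    (h : (c • Δ.character k) • (wedgeD fun i => Δ.character (e.coord i)) =
      (d • Δ.character l) • wedgeD fun i => Δ.character (b.coord i)) :
    k + ∑ i, e.coord i = l + ∑ i, b.coord i := by
  have hmap := congrArg (AlgForm.map n (Δ.torusEquiv : _ →ₐ[ℂ] CoordRing Δ.zeroCone.1)) h
  simp only [AlgForm.map_smul_wedgeD, AlgEquiv.coe_toAlgHom, map_smul, Δ.torusEquiv_character]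
    at hmap
  simpa using congrArg Subtype.val (add_sum_eq_of_smul_wedgeD_chi_eq (fun _ => rfl) hc hmap)

lemma dual_eq_zero_of_span_toReal_eq_top {S : Set N}
    (hS : Submodule.span ℝ (toReal '' S) = ⊤) {m : Module.Dual ℤ N} (hm : ∀ v ∈ S, m v = 0) :
    m = 0 := by
  have hpair : m.baseChange ℝ = 0 := LinearMap.ext_on hS <| by
    rintro _ ⟨v, hv, rfl⟩
    simp [hm v hv]
  ext v
  have := pair_toReal m v
  rw [pair, hpair] at this
  simpa using this.symm

end Torus

end Toric

end

theorem proposition2p1_general {N : Type} [AddCommGroup N] (Δ : Toric.Fan N) {n : ℕ}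
    (e : Module.Basis (Fin n) ℤ N) {S : Set N}
    (hray : ∀ v ∈ S, PointedCone.hull ℝ {Toric.toReal v} ∈ Δ.cones)
    (hone : ∀ v ∈ S, (∑ i, e.coord i) v = 1)
    (hspan : Submodule.span ℝ (Toric.toReal '' S) = ⊤)
    (Ω : Toric.RegularForm Δ.toricVariety n) (hΩ : Ω.NowhereVanishing) :
    ∃ C : ℂ, Ω.form Δ.torus = C • Toric.wedgeD fun i => Δ.character (e.coord i) := by
  obtain ⟨k, c, hc, -, htorus⟩ := Ω.exists_form_torus_eq hΩ e (J := ∅) (τ := Δ.zeroCone)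
    (by simp [Toric.Fan.zeroCone])
  suffices hk : k = 0 from
    ⟨c, by rw [htorus, hk, Δ.character_zero, smul_assoc, one_smul]⟩
  refine Toric.dual_eq_zero_of_span_toReal_eq_top hspan fun v hv => ?_
  obtain ⟨b, i, rfl⟩ := Toric.exists_basis_of_dual_apply_eq_one e (hone v hv)
  obtain ⟨l, d, -, hl, hchart⟩ := Ω.exists_form_torus_eq hΩ b (J := {i}) (τ := ⟨_, hray _ hv⟩)
    (by simp)
  have hkl := LinearMap.congr_fun
    (Toric.Fan.add_sum_coord_eq_of_smul_wedgeD_eq hc (htorus.symm.trans hchart)) (b i)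
  have hb : (∑ j, b.coord j) (b i) = 1 := by
    simp [Finsupp.single_apply]
  rw [LinearMap.add_apply, LinearMap.add_apply, hone _ hv, hl i rfl, hb] at hkl
  simpa using hkl

theorem proposition2p1 {N : Type} [AddCommGroup N] [Module.Free ℤ N] [Module.Finite ℤ N]
    (σ : PointedCone ℝ (Toric.RealSpan N)) (m₀ : Module.Dual ℤ N)
    (hσ : Toric.IsGorensteinCanonical σ m₀)
    (hfull : Submodule.span ℝ (σ : Set (Toric.RealSpan N)) = ⊤)
    (K : Geometry.SimplicialComplex ℝ (Toric.RealSpan N))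
    (hK : K.space = Toric.rayPolytope σ)
    (Δ : Toric.Fan N) (hΔ : Δ.IsConeOver K)
    (hsmooth : Smooth Δ.toricVariety.hom)
    {n : ℕ} (e : Module.Basis (Fin n) ℤ N) (he : m₀ = ∑ i, e.coord i)
    (Ω : Toric.RegularForm Δ.toricVariety n) (hΩ : Ω.NowhereVanishing) :
    ∃ C : ℂ, Ω.form Δ.torus = C • Toric.wedgeD fun i => Δ.character (e.coord i) :=
  proposition2p1_general Δ e
    (fun _ hv => hΔ.hull_mem_cones (Toric.mem_vertices_of_mem_extremePoints
      (hK ▸ Toric.toReal_mem_extremePoints_rayPolytope hσ.apply_rayGenerator hv)))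
    (fun v hv => he ▸ hσ.apply_rayGenerator v hv)
    (hσ.stronglyConvexRational.span_rayGenerators.trans hfull) Ω hΩ
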